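/- Let $X$ and $Y$ be Banach spaces over $\mathbb{K}\in\{\mathbb{R},\mathbb{C}\}$, with $X$ separable and reflexive, and let $\mathcal{L}$ be a family of continuous linear operators $L\colon X\to Y$, equipped with a $\sigma$-compact, locally compact Hausdorff topology such that for every $x\in X$ the map $\mathcal{L}\to Y$, $L\mapsto Lx$, is continuous. Put $$M=\Big\{x\in X:\ \sup_{L\in\mathcal{L}}\|Lx\|_Y<\infty\Big\},\qquad \|x\|_M=\sup_{L\in\mathcal{L}}\|Lx\|_Y,\qquad M_0=\Big\{x\in M:\ \lim_{\mathcal{L}\ni L\to\infty}\|Lx\|_Y=0\Big\},$$ where $L\to\infty$ means that $L$ leaves every compact subset of $\mathcal{L}$, and $M_0$ carries the norm of $M$. Suppose that $\|\cdot\|_M$ is a norm on $M$ stronger than the norm of $X$, i.e. there is a constant $C$ with $\|x\|_X\le C\|x\|_M$ for all $x\in M$, and that for every $x\in M$ there is a sequence $(x_n)$ in $M_0$ with $\sup_n\|x_n\|_M<\infty$ that converges to $x$ weakly in $X$. Let $Z$ be a Banach space over $\mathbb{K}$ and let $T\colon M_0\to Z$ be a bounded linear operator. Then $T$ is weakly compact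 (i.e. the image of the closed unit ball of $M_0$ is relatively weakly compact in $Z$) if and only if for every $\varepsilon>0$ there exists $N>0$ such that $$\|Tx\|_Z\le N\|x\|_X+\varepsilon\|x\|_M\qquad\text{for all }x\in M_0 .$$ -/

import Mathlib

open Filter Topology Set

noncomputable section

/-- A Banach space is reflexive if the canonical embedding into its bidual is onto. -/
def IsReflexiveSpace (𝕜 X : Type*) [RCLike 𝕜] [NormedAddCommGroup X] [NormedSpace 𝕜 X] : Prop :=
  Function.Surjective (NormedSpace.inclusionInDoubleDual 𝕜 X)

/-- A bounded operator is weakly compact if the image of the closed unit ball is relatively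
compact in the weak topology of the target. -/
def IsWeaklyCompactOp {𝕜 E Z : Type*} [RCLike 𝕜] [NormedAddCommGroup E] [NormedSpace 𝕜 E]
    [NormedAddCommGroup Z] [NormedSpace 𝕜 Z] (T : E →L[𝕜] Z) : Prop :=
  IsCompact (closure (toWeakSpace 𝕜 Z '' (T '' Metric.closedBall (0 : E) 1)))

/-- A family of bounded operators `X → Y` indexed by a topological space `Λ`, such that
`l ↦ op l x` is continuous for every `x`, and such that `x ↦ sup_l ‖op l x‖` dominates the norm
of `X` (up to a constant) on the space where it is finite. A set of operators carrying its own
topology is the case where `op` is the inclusion of that set. -/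
structure OperatorFamily (𝕜 X Y Λ : Type*) [RCLike 𝕜] [NormedAddCommGroup X] [NormedSpace 𝕜 X]
    [NormedAddCommGroup Y] [NormedSpace 𝕜 Y] [TopologicalSpace Λ] where
  op : Λ → X →L[𝕜] Y
  continuous_op : ∀ x : X, Continuous fun l => op l x
  exists_norm_le : ∃ C : ℝ, ∀ x : X, BddAbove (range fun l => ‖op l x‖) →
    ‖x‖ ≤ C * ⨆ l, ‖op l x‖

namespace OperatorFamily

variable {𝕜 X Y Λ : Type*} [RCLike 𝕜] [NormedAddCommGroup X] [NormedSpace 𝕜 X]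
  [NormedAddCommGroup Y] [NormedSpace 𝕜 Y] [TopologicalSpace Λ]

/-- The vectors `x` of `X` with `sup_l ‖op l x‖ < ∞`. -/
def bigO (F : OperatorFamily 𝕜 X Y Λ) : Submodule 𝕜 X where
  carrier := {x | BddAbove (range fun l => ‖F.op l x‖)}
  zero_mem' := ⟨0, by rintro _ ⟨l, rfl⟩; simp⟩
  add_mem' := by
    rintro x y ⟨a, ha⟩ ⟨b, hb⟩
    refine ⟨a + b, ?_⟩
    rintro _ ⟨l, rfl⟩
    have h1 : ‖F.op l x‖ ≤ a := ha ⟨l, rfl⟩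
    have h2 : ‖F.op l y‖ ≤ b := hb ⟨l, rfl⟩
    simp only [map_add]
    exact (norm_add_le _ _).trans (add_le_add h1 h2)
  smul_mem' := by
    rintro c x ⟨a, ha⟩
    refine ⟨‖c‖ * a, ?_⟩
    rintro _ ⟨l, rfl⟩
    have h1 : ‖F.op l x‖ ≤ a := ha ⟨l, rfl⟩
    simp only [map_smul, norm_smul]
    exact mul_le_mul_of_nonneg_left h1 (norm_nonneg c)

/-- The space `M`: a copy of `bigO`, carrying the norm `sup_l ‖op l x‖` and not that of `X`. -/
def M (F : OperatorFamily 𝕜 X Y Λ) : Type _ := F.bigO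

instance (F : OperatorFamily 𝕜 X Y Λ) : AddCommGroup F.M :=
  inferInstanceAs (AddCommGroup F.bigO)

instance (F : OperatorFamily 𝕜 X Y Λ) : Module 𝕜 F.M :=
  inferInstanceAs (Module 𝕜 F.bigO)

/-- The inclusion of `M` into `X`. -/
def incl (F : OperatorFamily 𝕜 X Y Λ) : F.M →ₗ[𝕜] X := F.bigO.subtype

instance (F : OperatorFamily 𝕜 X Y Λ) : Norm F.M := ⟨fun x => ⨆ l, ‖F.op l (F.incl x)‖⟩

theorem norm_def (F : OperatorFamily 𝕜 X Y Λ) (x : F.M) :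
    ‖x‖ = ⨆ l, ‖F.op l (F.incl x)‖ := rfl

theorem norm_op_le (F : OperatorFamily 𝕜 X Y Λ) (x : F.M) (l : Λ) :
    ‖F.op l (F.incl x)‖ ≤ ‖x‖ := le_ciSup (f := fun l => ‖F.op l (F.incl x)‖) x.2 l

theorem core (F : OperatorFamily 𝕜 X Y Λ) : NormedSpace.Core 𝕜 F.M where
  norm_nonneg x := Real.iSup_nonneg fun l => norm_nonneg _
  norm_smul c x := by
    simp only [norm_def, map_smul, norm_smul]
    exact (Real.mul_iSup_of_nonneg (norm_nonneg c) _).symm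
  norm_triangle x y := by
    refine Real.iSup_le (fun l => ?_) (add_nonneg (Real.iSup_nonneg fun l => norm_nonneg _)
      (Real.iSup_nonneg fun l => norm_nonneg _))
    simp only [map_add]
    exact (norm_add_le _ _).trans (add_le_add (F.norm_op_le x l) (F.norm_op_le y l))
  norm_eq_zero_iff x := by
    constructor
    · intro h
      obtain ⟨C, hC⟩ := F.exists_norm_le
      have h1 : ‖F.incl x‖ ≤ C * ‖x‖ := hC (F.incl x) x.2
      rw [h, mul_zero] at h1
      exact Subtype.ext (norm_le_zero_iff.mp h1)
    · rintro rfl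
      simp [norm_def]

instance (F : OperatorFamily 𝕜 X Y Λ) : NormedAddCommGroup F.M :=
  NormedAddCommGroup.ofCore F.core

instance (F : OperatorFamily 𝕜 X Y Λ) : NormedSpace 𝕜 F.M :=
  NormedSpace.ofCore F.core

/-- The subspace `M₀` of `M` of those `x` with `‖op l x‖ → 0` as `l → ∞`, that is, as `l` leaves
every compact subset of `Λ`; it carries the norm of `M`. -/
def M₀ (F : OperatorFamily 𝕜 X Y Λ) : Submodule 𝕜 F.M where
  carrier := {x | Tendsto (fun l => ‖F.op l (F.incl x)‖) (cocompact Λ) (𝓝 0)}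
  zero_mem' := by simpa using tendsto_const_nhds
  add_mem' := by
    intro x y hx hy
    simp only [Set.mem_ofPred_eq, ← tendsto_zero_iff_norm_tendsto_zero] at *
    simpa using hx.add hy
  smul_mem' := by
    intro c x hx
    simp only [Set.mem_ofPred_eq, ← tendsto_zero_iff_norm_tendsto_zero] at *
    simpa using hx.const_smul c

/-- Every `x ∈ M` is the weak limit in `X` of a sequence in `M₀` that is bounded in the norm
of `M`. -/
def HasApproximation (F : OperatorFamily 𝕜 X Y Λ) : Prop :=
  ∀ x : F.M, ∃ u : ℕ → F.M₀, (∃ C : ℝ, ∀ n, ‖u n‖ ≤ C) ∧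
    Tendsto (fun n => toWeakSpace 𝕜 X (F.incl (u n : F.M))) atTop
      (𝓝 (toWeakSpace 𝕜 X (F.incl x)))

end OperatorFamily

end

/-! If the estimate fails for some `ε`, there are unit vectors of `M₀` with `‖T x‖ > ε` and
arbitrarily small `X`-norm, hence small under all operators of a given compact set. A gliding hump
extracts a sequence spanning a weakly unconditionally Cauchy series; a weakly compact operator must
send its terms close to `0` (`IsWeaklyCompactOp.exists_norm_lt`, an Orlicz–Pettis argument via
Baire), a contradiction. Conversely, the unit ball of `M₀` is relatively weakly compact in `X`.
Mazur's lemma turns weak into norm convergence in `X`, and the estimate carries it to `Z` up to `ε`,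
so weak-* limits in the bidual of `Z` lie in `Z` (`isWeaklyCompactOp_of_norm_le_add`). -/

/-! ### Domination implies weak compactness -/

theorem IsReflexiveSpace.exists_tendsto_toWeakSpace {𝕜 X ι : Type*} [RCLike 𝕜]
    [NormedAddCommGroup X] [NormedSpace 𝕜 X] (hX : IsReflexiveSpace 𝕜 X) (U : Ultrafilter ι)
    (f : ι → X) {r : ℝ} (hf : ∀ᶠ i in U, ‖f i‖ ≤ r) :
    ∃ x, Tendsto (fun i => toWeakSpace 𝕜 X (f i)) U (𝓝 (toWeakSpace 𝕜 X x)) := by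
  let e := NormedSpace.inclusionInDoubleDualWeak 𝕜 X
  have hK := WeakDual.isCompact_closedBall (𝕜 := 𝕜) (E := StrongDual 𝕜 X) 0 r
  have hle : ↑(U.map fun i => e (toWeakSpace 𝕜 X (f i))) ≤
      𝓟 (WeakDual.toStrongDual (𝕜 := 𝕜) (E := StrongDual 𝕜 X) ⁻¹' Metric.closedBall 0 r) := by
    rw [le_principal_iff]
    refine Ultrafilter.mem_map.2 ?_
    filter_upwards [hf] with i hi
    have h := (NormedSpace.double_dual_bound 𝕜 X (f i)).trans hi
    exact (mem_closedBall_zero_iff (E := StrongDual 𝕜 (StrongDual 𝕜 X))).2 h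
  obtain ⟨w, -, hw⟩ := hK.ultrafilter_le_nhds _ hle
  obtain ⟨x, hx⟩ := hX w.toStrongDual
  refine ⟨x, (NormedSpace.isEmbedding_inclusionInDoubleDualWeak 𝕜 X).tendsto_nhds_iff.2 ?_⟩
  have hxw : e (toWeakSpace 𝕜 X x) = w := hx
  change Tendsto _ _ (𝓝 (e (toWeakSpace 𝕜 X x)))
  rw [hxw]
  exact hw

/-- **Mazur's lemma** along a filter. -/
theorem exists_mem_convexHull_norm_sub_lt_of_tendsto_toWeakSpace {𝕜 E X : Type*} [RCLike 𝕜]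
    [NormedAddCommGroup E] [NormedSpace ℝ E]
    [NormedAddCommGroup X] [NormedSpace 𝕜 X] [NormedSpace ℝ X] [IsScalarTower ℝ 𝕜 X]
    (J : E →ₗ[ℝ] X) {l : Filter E} [l.NeBot] {x : X}
    (hx : Tendsto (fun e => toWeakSpace 𝕜 X (J e)) l (𝓝 (toWeakSpace 𝕜 X x)))
    {V : Set E} (hV : V ∈ l) {δ : ℝ} (hδ : 0 < δ) :
    ∃ y ∈ convexHull ℝ V, ‖J y - x‖ < δ := by
  have hmem : toWeakSpace 𝕜 X x ∈ closure (toWeakSpace 𝕜 X '' (J '' convexHull ℝ V)) := by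
    refine mem_closure_of_tendsto hx ?_
    filter_upwards [hV] with e he
    exact mem_image_of_mem _ (mem_image_of_mem _ (subset_convexHull ℝ V he))
  rw [← ((convex_convexHull ℝ V).linear_image J).toWeakSpace_closure 𝕜] at hmem
  have hmem' := (toWeakSpace 𝕜 X).injective.mem_set_image.1 hmem
  obtain ⟨_, ⟨y, hy, rfl⟩, hd⟩ := Metric.mem_closure_iff.1 hmem' δ hδ
  exact ⟨y, hy, by rwa [← dist_eq_norm, dist_comm]⟩

/-- An operator dominated, up to an arbitrarily small multiple of the norm, by an operator into a
reflexive space is weakly compact. -/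
theorem isWeaklyCompactOp_of_norm_le_add {𝕜 E X Z : Type*} [RCLike 𝕜]
    [NormedAddCommGroup E] [NormedSpace 𝕜 E] [NormedAddCommGroup X] [NormedSpace 𝕜 X]
    [NormedAddCommGroup Z] [NormedSpace 𝕜 Z] [CompleteSpace Z]
    (hX : IsReflexiveSpace 𝕜 X) (J : E →L[𝕜] X) (T : E →L[𝕜] Z)
    (h : ∀ ε : ℝ, 0 < ε → ∃ N : ℝ, 0 < N ∧ ∀ x, ‖T x‖ ≤ N * ‖J x‖ + ε * ‖x‖) :
    IsWeaklyCompactOp T := by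
  let _ : NormedSpace ℝ E := NormedSpace.restrictScalars ℝ 𝕜 E
  let _ : NormedSpace ℝ X := NormedSpace.restrictScalars ℝ 𝕜 X
  let _ : NormedSpace ℝ Z := NormedSpace.restrictScalars ℝ 𝕜 Z
  have : IsScalarTower ℝ 𝕜 E := IsScalarTower.restrictScalars ℝ 𝕜 E
  have : IsScalarTower ℝ 𝕜 X := IsScalarTower.restrictScalars ℝ 𝕜 X
  have : IsScalarTower ℝ 𝕜 Z := IsScalarTower.restrictScalars ℝ 𝕜 Z
  -- It remains to show that the weak-* closure of the image in the bidual stays inside `Z`.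
  refine NormedSpace.isCompact_closure_of_isBounded 𝕜 Z _ ?_ ?_
  · rw [preimage_image_eq _ (toWeakSpace 𝕜 Z).injective]
    exact T.lipschitz.isBounded_image Metric.isBounded_closedBall
  intro z hz
  obtain ⟨G, hG, hGz⟩ := mem_closure_iff_ultrafilter.1 hz
  rw [image_image, image_image] at hG
  let U := Ultrafilter.ofComapInfPrincipal hG
  have hUB : Metric.closedBall (0 : E) 1 ∈ U := Ultrafilter.ofComapInfPrincipal_mem hG
  have hUz : Tendsto (fun e => NormedSpace.inclusionInDoubleDualWeak 𝕜 Z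
      (toWeakSpace 𝕜 Z (T e))) U (𝓝 z) := by
    have := Ultrafilter.ofComapInfPrincipal_eq_of_map hG
    rw [← this] at hGz
    exact hGz
  have hUg (g : StrongDual 𝕜 Z) : Tendsto (fun e => g (T e)) U (𝓝 (z g)) :=
    ((WeakDual.eval_continuous g).tendsto z).comp hUz
  obtain ⟨x, hx⟩ := hX.exists_tendsto_toWeakSpace U J (r := ‖J‖) (by
    filter_upwards [hUB] with e he
    exact J.unit_le_opNorm e (mem_closedBall_zero_iff.1 he))
  have hmazur {V : Set E} (hV : V ∈ U) {δ : ℝ} (hδ : 0 < δ) :=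
    exists_mem_convexHull_norm_sub_lt_of_tendsto_toWeakSpace
      ((J : E →ₗ[𝕜] X).restrictScalars ℝ) (l := (U : Filter E)) hx hV hδ
  have hcl : IsClosed (range (NormedSpace.inclusionInDoubleDual 𝕜 Z)) :=
    by
    have := (NormedSpace.inclusionInDoubleDualLi (E := Z) 𝕜).isometry.isUniformInducing
    exact this.isComplete_range.isClosed
  suffices hmem : z.toStrongDual ∈ closure (range (NormedSpace.inclusionInDoubleDual 𝕜 Z)) by
    rw [hcl.closure_eq] at hmem
    obtain ⟨w, hw⟩ := hmem
    exact ⟨toWeakSpace 𝕜 Z w, hw⟩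
  refine (Metric.mem_closure_iff (α := StrongDual 𝕜 (StrongDual 𝕜 Z))).2 fun ε hε => ?_
  obtain ⟨N, hN, hT⟩ := h (ε / 8) (by positivity)
  have hδ : 0 < ε / (8 * N) := by positivity
  have hball {V : Set E} (hV : V ⊆ Metric.closedBall 0 1) {y} (hy : y ∈ convexHull ℝ V) :
      ‖y‖ ≤ 1 :=
    mem_closedBall_zero_iff.1 (convexHull_min hV (convex_closedBall (0 : E) 1) hy)
  -- `y₀` is fixed before the functional `g`, so `T y₀` approximates `z` uniformly in `g`; only the
  -- auxiliary `y` below depends on `g` and `η`.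
  obtain ⟨y₀, hy₀, hJ₀⟩ := hmazur hUB hδ
  refine ⟨_, mem_range_self (T y₀), ?_⟩
  refine (dist_eq_norm (E := StrongDual 𝕜 (StrongDual 𝕜 Z)) _ _).trans_lt ?_
  refine lt_of_le_of_lt (ContinuousLinearMap.opNorm_le_bound _ (M := ε / 2) (by positivity)
    fun g => ?_) (by linarith)
  refine le_of_forall_pos_le_add fun η hη => ?_
  let W : Set E := Metric.closedBall 0 1 ∩ {e | g (T e) ∈ Metric.closedBall (z g) η}
  have hW : W ∈ U := inter_mem hUB ((hUg g) (Metric.closedBall_mem_nhds _ hη))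
  obtain ⟨y, hy, hJ⟩ := hmazur hW hδ
  have hyW : g (T y) ∈ Metric.closedBall (z g) η := by
    have hconv : Convex ℝ {e | g (T e) ∈ Metric.closedBall (z g) η} :=
      (convex_closedBall (z g) η).linear_preimage
        (((g.comp T : E →L[𝕜] 𝕜) : E →ₗ[𝕜] 𝕜).restrictScalars ℝ)
    exact convexHull_min inter_subset_right hconv hy
  rw [mem_closedBall_iff_norm'] at hyW
  have hy1 := hball inter_subset_left hy
  have hy₀1 := hball subset_rfl hy₀
  have hJd : ‖J (y - y₀)‖ ≤ 2 * (ε / (8 * N)) := by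
    have : J (y - y₀) = (J y - x) - (J y₀ - x) := by rw [map_sub]; abel
    rw [this]
    refine (norm_sub_le _ _).trans ?_
    have h1 : ‖J y - x‖ < _ := hJ
    have h2 : ‖J y₀ - x‖ < _ := hJ₀
    linarith
  have hTd : ‖T (y - y₀)‖ ≤ ε / 2 := by
    have h1 := hT (y - y₀)
    have h2 : ‖y - y₀‖ ≤ 2 := (norm_sub_le _ _).trans (by linarith)
    have h3 : N * ‖J (y - y₀)‖ ≤ N * (2 * (ε / (8 * N))) := by gcongr
    have h4 : N * (2 * (ε / (8 * N))) = ε / 4 := by field_simp; norm_num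
    have h5 : ε / 8 * ‖y - y₀‖ ≤ ε / 8 * 2 := by gcongr
    linarith
  have hsplit : z g - g (T y₀) = (z g - g (T y)) + g (T (y - y₀)) := by
    rw [map_sub, map_sub]; ring
  change ‖z g - g (T y₀)‖ ≤ _
  rw [hsplit]
  refine (norm_add_le _ _).trans ?_
  have h6 : ‖g (T (y - y₀))‖ ≤ ‖g‖ * (ε / 2) := (g.le_opNorm _).trans (by gcongr)
  linarith

/-! ### Weakly unconditionally Cauchy series -/

/-- If the series `∑ z k` is such that every subseries is weakly summable, then its terms cannot
be bounded away from `0` in norm. -/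
theorem exists_norm_lt_of_weakly_subseries_summable {𝕜 Z : Type*} [RCLike 𝕜]
    [NormedAddCommGroup Z] [NormedSpace 𝕜 Z] (z : ℕ → Z)
    (hz : ∀ g : StrongDual 𝕜 Z, Summable fun k => ‖g (z k)‖)
    (f : (ℕ → Bool) → Z) (hsep : TopologicalSpace.IsSeparable (range f))
    (hf : ∀ (A : ℕ → Bool) (g : StrongDual 𝕜 Z),
      g (f A) = ∑' k, if A k then g (z k) else 0)
    {ε : ℝ} (hε : 0 < ε) : ∃ k, ‖z k‖ < ε := by
  have hbd (A : ℕ → Bool) (g : StrongDual 𝕜 Z) (k : ℕ) :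
      ‖(if A k then g (z k) else 0 : 𝕜)‖ ≤ ‖g (z k)‖ := by split_ifs <;> simp
  have hcont (g : StrongDual 𝕜 Z) : Continuous fun A => g (f A) := by
    simp only [hf]
    refine continuous_tsum (fun k => ?_) (hz g) fun k A => hbd A g k
    exact (continuous_of_discreteTopology (f := fun b : Bool => if b then g (z k) else 0)).comp
      (continuous_apply k)
  -- `f` is only weakly continuous, but norm balls are cut out by functionals.
  have hclosed (c : Z) : IsClosed {A | ‖f A - c‖ ≤ ε / 3} := by
    have : {A | ‖f A - c‖ ≤ ε / 3} =
        ⋂ g : StrongDual 𝕜 Z, {A | ‖g (f A) - g c‖ ≤ ε / 3 * ‖g‖} := by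
      ext A
      simp only [mem_iInter, mem_ofPred_eq, ← map_sub]
      refine ⟨fun h g => (g.le_opNorm _).trans ?_,
        fun h => NormedSpace.norm_le_dual_bound 𝕜 _ (by positivity) h⟩
      rw [mul_comm]; gcongr
    rw [this]
    exact isClosed_iInter fun g => isClosed_le ((hcont g).sub continuous_const).norm
      continuous_const
  obtain ⟨D, hDc, hD⟩ := hsep
  have : Countable D := hDc
  have hcover : ⋃ c : D, {A | ‖f A - c‖ ≤ ε / 3} = univ := by
    refine eq_univ_of_forall fun A => mem_iUnion.2 ?_
    obtain ⟨c, hc, hd⟩ := Metric.mem_closure_iff.1 (hD (mem_range_self A)) (ε / 3) (by positivity)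
    exact ⟨⟨c, hc⟩, by rw [dist_eq_norm] at hd; exact hd.le⟩
  -- Baire on the Cantor space. Flipping a far coordinate `k` of `A` stays in the interior and
  -- changes `f` by `± z k`.
  obtain ⟨c, A, hA⟩ := nonempty_interior_of_iUnion_of_closed (fun c : D => hclosed c) hcover
  have htend : Tendsto (fun k => Function.update A k (!A k)) atTop (𝓝 A) := by
    refine tendsto_pi_nhds.2 fun i => tendsto_const_nhds.congr' ?_
    filter_upwards [eventually_gt_atTop i] with k hk
    rw [Function.update_of_ne hk.ne]
  obtain ⟨k, hk⟩ := (htend.eventually (isOpen_interior.mem_nhds hA)).exists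
  have h1 : ‖f (Function.update A k (!A k)) - c‖ ≤ ε / 3 :=
    interior_subset (s := {A | ‖f A - c‖ ≤ ε / 3}) hk
  have h2 : ‖f A - c‖ ≤ ε / 3 := interior_subset (s := {A | ‖f A - c‖ ≤ ε / 3}) hA
  have hdiff (g : StrongDual 𝕜 Z) :
      ‖g (z k)‖ = ‖g (f (Function.update A k (!A k)) - f A)‖ := by
    have hs (B : ℕ → Bool) : Summable fun k => (if B k then g (z k) else 0 : 𝕜) :=
      (hz g).of_norm_bounded (hbd B g)
    rw [map_sub, hf, hf, ← (hs _).tsum_sub (hs _), tsum_eq_single k]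
    · cases hAk : A k <;> simp
    · intro j hj
      simp [Function.update_of_ne hj]
  refine ⟨k, lt_of_le_of_lt (NormedSpace.norm_le_dual_bound 𝕜 _ (M := ε / 3 + ε / 3)
    (by positivity) fun g => ?_) (by linarith)⟩
  rw [hdiff, mul_comm]
  refine (g.le_opNorm _).trans ?_
  gcongr
  rw [← sub_sub_sub_cancel_right _ _ (c : Z)]
  exact (norm_sub_le _ _).trans (add_le_add h1 h2)

/-- A weakly compact operator cannot be bounded below on the terms of a weakly unconditionally
Cauchy series. -/
theorem IsWeaklyCompactOp.exists_norm_lt {𝕜 E Z : Type*} [RCLike 𝕜]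
    [NormedAddCommGroup E] [NormedSpace 𝕜 E] [NormedAddCommGroup Z] [NormedSpace 𝕜 Z]
    {T : E →L[𝕜] Z} (hT : IsWeaklyCompactOp T) (y : ℕ → E)
    (hy : ∀ (s : Finset ℕ) (a : ℕ → 𝕜), (∀ k, ‖a k‖ ≤ 1) → ‖∑ k ∈ s, a k • y k‖ ≤ 1)
    {ε : ℝ} (hε : 0 < ε) : ∃ k, ‖T (y k)‖ < ε := by
  let _ : NormedSpace ℝ Z := NormedSpace.restrictScalars ℝ 𝕜 Z
  have : IsScalarTower ℝ 𝕜 Z := IsScalarTower.restrictScalars ℝ 𝕜 Z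
  have hz (g : StrongDual 𝕜 Z) : Summable fun k => ‖g (T (y k))‖ := by
    choose a ha1 ha using fun k => RCLike.exists_norm_eq_mul_self (g (T (y k)))
    refine summable_of_sum_le (c := ‖g.comp T‖) (fun k => norm_nonneg _) fun s => ?_
    have hsum : ((∑ k ∈ s, ‖g (T (y k))‖ : ℝ) : 𝕜) = g.comp T (∑ k ∈ s, a k • y k) := by
      simp [ha]
    have hnonneg : 0 ≤ ∑ k ∈ s, ‖g (T (y k))‖ := Finset.sum_nonneg fun _ _ => norm_nonneg _
    rw [← RCLike.norm_of_nonneg (K := 𝕜) hnonneg, hsum]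
    exact (g.comp T).unit_le_opNorm _ (hy s a fun k => (ha1 k).le)
  let S : Submodule 𝕜 Z := Submodule.span 𝕜 (range fun k => T (y k))
  have hlim (A : ℕ → Bool) : ∃ w ∈ closure (S : Set Z), ∀ g : StrongDual 𝕜 Z,
      g w = ∑' k, if A k then g (T (y k)) else 0 := by
    let a : ℕ → 𝕜 := fun k => if A k then 1 else 0
    let p : ℕ → E := fun n => ∑ k ∈ Finset.range n, a k • y k
    have ha (k) : ‖a k‖ ≤ 1 := by simp only [a]; split_ifs <;> simp
    have hp (n) : toWeakSpace 𝕜 Z (T (p n)) ∈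
        closure (toWeakSpace 𝕜 Z '' (T '' Metric.closedBall (0 : E) 1)) :=
      subset_closure (mem_image_of_mem _ (mem_image_of_mem _
        (mem_closedBall_zero_iff.2 (hy _ a ha))))
    -- Weak compactness gives a cluster point of the partial sums; each scalar series converges, so
    -- its sum is the value there.
    obtain ⟨w, -, hw⟩ := hT.exists_mapClusterPt (f := atTop)
      (u := fun n => toWeakSpace 𝕜 Z (T (p n))) (tendsto_principal.2 (Eventually.of_forall hp))
    obtain ⟨w, rfl⟩ := (toWeakSpace 𝕜 Z).surjective w
    refine ⟨w, ?_, fun g => ?_⟩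
    · have hconv : Convex ℝ (S : Set Z) := (S.restrictScalars ℝ).convex
      rw [← (toWeakSpace 𝕜 Z).injective.mem_set_image, hconv.toWeakSpace_closure 𝕜]
      refine isClosed_closure.mem_of_mapClusterPt hw (Eventually.of_forall fun n => ?_)
      refine subset_closure (mem_image_of_mem _ ?_)
      simp only [p, map_sum, map_smul]
      exact S.sum_mem fun k _ => S.smul_mem _ (Submodule.subset_span (mem_range_self k))
    · have hg : Continuous fun v : WeakSpace 𝕜 Z => g ((toWeakSpace 𝕜 Z).symm v) :=
        WeakBilin.eval_continuous (topDualPairing 𝕜 Z).flip g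
      have hcl := hw.continuousAt_comp (f := fun v => g ((toWeakSpace 𝕜 Z).symm v))
        hg.continuousAt
      have hs : Summable fun k => (if A k then g (T (y k)) else 0 : 𝕜) :=
        (hz g).of_norm_bounded fun k => by split_ifs <;> simp
      have htend := hs.hasSum.tendsto_sum_nat
      have heq : (fun v => g ((toWeakSpace 𝕜 Z).symm v)) ∘
          (fun n => toWeakSpace 𝕜 Z (T (p n))) =
          fun n => ∑ k ∈ Finset.range n, (if A k then g (T (y k)) else 0 : 𝕜) := by
        ext n
        simp only [p, a, Function.comp_apply, LinearEquiv.symm_apply_apply, map_sum]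
        refine Finset.sum_congr rfl fun k _ => ?_
        split_ifs <;> simp
      rw [heq] at hcl
      exact eq_of_nhds_neBot (hcl.clusterPt.mono htend)
  choose f hfS hf using hlim
  refine exists_norm_lt_of_weakly_subseries_summable (𝕜 := 𝕜) (fun k => T (y k)) hz f ?_ hf hε
  have hsep : TopologicalSpace.IsSeparable (S : Set Z) :=
    (countable_range _).isSeparable.span
  exact hsep.closure.mono (range_subset_iff.2 hfS)

/-! ### The gliding hump in `M₀` -/

namespace OperatorFamily

variable {𝕜 X Y Λ : Type*} [RCLike 𝕜] [NormedAddCommGroup X] [NormedSpace 𝕜 X]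
  [NormedAddCommGroup Y] [NormedSpace 𝕜 Y] [TopologicalSpace Λ]

theorem exists_bound_norm_incl (F : OperatorFamily 𝕜 X Y Λ) :
    ∃ C : ℝ, ∀ x : F.M, ‖F.incl x‖ ≤ C * ‖x‖ := by
  obtain ⟨C, hC⟩ := F.exists_norm_le
  exact ⟨C, fun x => hC (F.incl x) x.2⟩

theorem exists_norm_op_le_of_isCompact [CompleteSpace X] (F : OperatorFamily 𝕜 X Y Λ) {K : Set Λ}
    (hK : IsCompact K) : ∃ C : ℝ, ∀ l ∈ K, ‖F.op l‖ ≤ C := by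
  obtain ⟨C, hC⟩ := banach_steinhaus (g := fun l : K => F.op l) fun x => by
    obtain ⟨C, hC⟩ := hK.exists_bound_of_continuousOn (F.continuous_op x).continuousOn
    exact ⟨C, fun l => hC l l.2⟩
  exact ⟨C, fun l hl => hC ⟨l, hl⟩⟩

theorem exists_isCompact_forall_notMem_norm_op_le (F : OperatorFamily 𝕜 X Y Λ) (x : F.M₀) {δ : ℝ}
    (hδ : 0 < δ) :
    ∃ K : Set Λ, IsCompact K ∧ ∀ l ∉ K, ‖F.op l (F.incl (x : F.M))‖ ≤ δ := by
  have hx : Tendsto (fun l => ‖F.op l (F.incl (x : F.M))‖) (cocompact Λ) (𝓝 0) := x.2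
  obtain ⟨K, hK, hsub⟩ := mem_cocompact.1 (hx.eventually (eventually_le_nhds hδ))
  exact ⟨K, hK, fun l hl => hsub hl⟩

/-- A gliding hump: a property which holds for unit vectors of `M₀` that are arbitrarily small on
any given compact set holds for all terms of a sequence with almost disjoint supports. -/
theorem exists_seq_sum_norm_op_le (F : OperatorFamily 𝕜 X Y Λ) (P : F.M₀ → Prop)
    (hP : ∀ K : Set Λ, IsCompact K → ∀ δ : ℝ, 0 < δ →
      ∃ x, P x ∧ ‖x‖ ≤ 1 ∧ ∀ l ∈ K, ‖F.op l (F.incl (x : F.M))‖ ≤ δ) :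
    ∃ x : ℕ → F.M₀, (∀ k, P (x k)) ∧
      ∀ (s : Finset ℕ) (l : Λ), ∑ k ∈ s, ‖F.op l (F.incl (x k : F.M))‖ ≤ 3 := by
  classical
  obtain ⟨u, hu, hur⟩ := exists_seq_of_forall_finset_exists
    (α := ℕ × F.M₀ × Set Λ)
    (fun a => P a.2.1 ∧ ‖a.2.1‖ ≤ 1 ∧ IsCompact a.2.2 ∧
      ∀ l ∉ a.2.2, ‖F.op l (F.incl (a.2.1 : F.M))‖ ≤ (1 / 2) ^ a.1)
    (fun a b => a.1 < b.1 ∧ ∀ l ∈ a.2.2, ‖F.op l (F.incl (b.2.1 : F.M))‖ ≤ (1 / 2) ^ b.1)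
    (by
      intro s hs
      let m := s.sup Prod.fst + 1
      have hδ : (0 : ℝ) < (1 / 2) ^ m := by positivity
      obtain ⟨x, hPx, hx1, hxK⟩ := hP (⋃ a ∈ s, a.2.2)
        (s.isCompact_biUnion fun a ha => (hs a ha).2.2.1) _ hδ
      obtain ⟨K, hK, hKx⟩ := F.exists_isCompact_forall_notMem_norm_op_le x hδ
      exact ⟨(m, x, K), ⟨hPx, hx1, hK, hKx⟩, fun a ha =>
        ⟨Nat.lt_succ_of_le (Finset.le_sup (f := Prod.fst) ha),
          fun l hl => hxK l (mem_biUnion ha hl)⟩⟩)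
  have hmono : StrictMono fun k => (u k).1 := fun m n h => (hur m n h).1
  have hpow (k : ℕ) : ((1 : ℝ) / 2) ^ (u k).1 ≤ (1 / 2) ^ k :=
    pow_le_pow_of_le_one (by norm_num) (by norm_num) (hmono.id_le k)
  refine ⟨fun k => (u k).2.1, fun k => (hu k).1, fun s l => ?_⟩
  set c : ℕ → ℝ := fun k => ‖F.op l (F.incl ((u k).2.1 : F.M))‖ with hc
  have hc1 (k) : c k ≤ 1 := (F.norm_op_le _ l).trans (hu k).2.1
  -- At each `l` at most one term exceeds its threshold; it contributes at most `1`, the others at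
  -- most `2`, whence the bound `3`.
  have huniq (i j : ℕ) (hij : i < j) (hi : (1 / 2 : ℝ) ^ i < c i) : c j ≤ (1 / 2) ^ j := by
    by_cases hl : l ∈ (u i).2.2
    · exact ((hur i j hij).2 l hl).trans (hpow j)
    · exact absurd (((hu i).2.2.2 l hl).trans (hpow i)) hi.not_ge
  have hcard : (s.filter fun k => (1 / 2 : ℝ) ^ k < c k).card ≤ 1 := by
    refine Finset.card_le_one.2 fun i hi j hj => ?_
    rw [Finset.mem_filter] at hi hj
    rcases lt_trichotomy i j with h | h | h
    · exact absurd (huniq i j h hi.2) hj.2.not_ge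
    · exact h
    · exact absurd (huniq j i h hj.2) hi.2.not_ge
  rw [← Finset.sum_filter_add_sum_filter_not s fun k => (1 / 2 : ℝ) ^ k < c k]
  have h1 : ∑ k ∈ s with (1 / 2 : ℝ) ^ k < c k, c k ≤ 1 := by
    refine (Finset.sum_le_card_nsmul _ _ 1 fun k _ => hc1 k).trans ?_
    rw [nsmul_one]
    exact_mod_cast hcard
  have h2 : ∑ k ∈ s with ¬ (1 / 2 : ℝ) ^ k < c k, c k ≤ 2 := by
    refine (Finset.sum_le_sum fun k hk => not_lt.1 (Finset.mem_filter.1 hk).2).trans ?_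
    refine (summable_geometric_two.sum_le_tsum _ fun k _ => by positivity).trans ?_
    exact tsum_geometric_two.le
  linarith

theorem exists_norm_le_of_isWeaklyCompactOp [CompleteSpace X] {Z : Type*} [NormedAddCommGroup Z]
    [NormedSpace 𝕜 Z] (F : OperatorFamily 𝕜 X Y Λ) {T : F.M₀ →L[𝕜] Z}
    (hT : IsWeaklyCompactOp T) {ε : ℝ} (hε : 0 < ε) :
    ∃ N : ℝ, 0 < N ∧ ∀ x : F.M₀, ‖T x‖ ≤ N * ‖F.incl (x : F.M)‖ + ε * ‖x‖ := by
  by_contra! hcon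
  obtain ⟨x, hxT, hxs⟩ := F.exists_seq_sum_norm_op_le (fun x => ε < ‖T x‖) (by
    intro K hK δ hδ
    obtain ⟨C, hC⟩ := F.exists_norm_op_le_of_isCompact hK
    -- The failed estimate gives `N * ‖x‖_X ≤ ‖T‖ * ‖x‖_M`; this `N` makes `‖op l x‖ ≤ δ * ‖x‖_M` on
    -- `K`.
    let N : ℝ := (|C| + 1) * (‖T‖ + 1) / δ
    have hN : 0 < N := by positivity
    obtain ⟨x, hx⟩ := hcon N hN
    have hx0 : 0 < ‖x‖ := norm_pos_iff.2 fun h => by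
      rw [h] at hx
      simp at hx
    have hincl (c : 𝕜) : F.incl ((c • x : F.M₀) : F.M) = c • F.incl (x : F.M) := by
      rw [Submodule.coe_smul, map_smul]
    have hxi := norm_nonneg (F.incl (x : F.M))
    have hc : ‖((‖x‖⁻¹ : ℝ) : 𝕜)‖ = ‖x‖⁻¹ := RCLike.norm_of_nonneg (by positivity)
    refine ⟨((‖x‖⁻¹ : ℝ) : 𝕜) • x, ?_, ?_, fun l hl => ?_⟩
    · rw [map_smul, norm_smul, hc, inv_mul_eq_div, lt_div_iff₀ hx0]
      have : 0 ≤ N * ‖F.incl (x : F.M)‖ := by positivity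
      linarith
    · rw [norm_smul, hc, inv_mul_cancel₀ hx0.ne']
    · rw [hincl, map_smul, norm_smul, hc, inv_mul_le_iff₀ hx0]
      have h1 : N * ‖F.incl (x : F.M)‖ ≤ ‖T‖ * ‖x‖ := by
        have := T.le_opNorm x
        have : 0 ≤ ε * ‖x‖ := by positivity
        linarith
      have h2 : (|C| + 1) * (‖T‖ + 1) * ‖F.incl (x : F.M)‖ ≤ δ * ((‖T‖ + 1) * ‖x‖) := by
        have h3 : (|C| + 1) * (‖T‖ + 1) = δ * N := by simp only [N]; field_simp
        rw [h3, mul_assoc]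
        refine mul_le_mul_of_nonneg_left ?_ hδ.le
        linarith
      have h4 : (|C| + 1) * ‖F.incl (x : F.M)‖ ≤ ‖x‖ * δ := by
        have hpos : 0 < ‖T‖ + 1 := by positivity
        refine le_of_mul_le_mul_left ?_ hpos
        linarith
      refine ((F.op l).le_opNorm _).trans (le_trans ?_ h4)
      gcongr
      linarith [hC l hl, le_abs_self C])
  -- Scaling by `1/3` puts all sums with coefficients of modulus at most `1` into the unit ball,
  -- while the images keep norm above `ε / 3`.
  obtain ⟨k, hk⟩ := hT.exists_norm_lt (fun k => (3⁻¹ : 𝕜) • x k) (by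
    intro s a ha
    change ‖((∑ k ∈ s, a k • (3⁻¹ : 𝕜) • x k : F.M₀) : F.M)‖ ≤ 1
    rw [F.norm_def]
    refine Real.iSup_le (fun l => ?_) zero_le_one
    have heq : F.op l (F.incl ((∑ k ∈ s, a k • (3⁻¹ : 𝕜) • x k : F.M₀) : F.M)) =
        ∑ k ∈ s, a k • (3⁻¹ : 𝕜) • F.op l (F.incl (x k : F.M)) := by
      simp only [Submodule.coe_sum, Submodule.coe_smul, map_sum, map_smul]
    rw [heq]
    calc _ ≤ ∑ k ∈ s, 3⁻¹ * ‖F.op l (F.incl (x k : F.M))‖ := by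
          refine norm_sum_le_of_le _ fun k _ => ?_
          rw [norm_smul, norm_smul, norm_inv, RCLike.norm_ofNat]
          exact mul_le_of_le_one_left (by positivity) (ha k)
      _ ≤ 1 := by
          rw [← Finset.mul_sum]
          linarith [hxs s l]) (ε := ε / 3) (by positivity)
  rw [map_smul, norm_smul, norm_inv, RCLike.norm_ofNat] at hk
  have := hxT k
  linarith

end OperatorFamily

theorem theorem3p2 {𝕜 X Y Z Λ : Type*} [RCLike 𝕜]
    [NormedAddCommGroup X] [NormedSpace 𝕜 X] [CompleteSpace X]
    [TopologicalSpace.SeparableSpace X] (hX : IsReflexiveSpace 𝕜 X)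
    [NormedAddCommGroup Y] [NormedSpace 𝕜 Y] [CompleteSpace Y]
    [NormedAddCommGroup Z] [NormedSpace 𝕜 Z] [CompleteSpace Z]
    [TopologicalSpace Λ] [T2Space Λ] [LocallyCompactSpace Λ] [SigmaCompactSpace Λ]
    (F : OperatorFamily 𝕜 X Y Λ) (hF : F.HasApproximation)
    (T : F.M₀ →L[𝕜] Z) :
    IsWeaklyCompactOp T ↔
      ∀ ε : ℝ, 0 < ε → ∃ N : ℝ, 0 < N ∧
        ∀ x : F.M₀, ‖T x‖ ≤ N * ‖F.incl (x : F.M)‖ + ε * ‖x‖ := by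
  refine ⟨fun hT ε hε => F.exists_norm_le_of_isWeaklyCompactOp hT hε, fun h => ?_⟩
  obtain ⟨C, hC⟩ := F.exists_bound_norm_incl
  exact isWeaklyCompactOp_of_norm_le_add hX
    ((F.incl.comp F.M₀.subtype).mkContinuous C fun x => hC x) T h
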